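/- **Setting.** A real square matrix $B=(b_{i,j})$ is a *Z-matrix* if $b_{i,j}\le 0$ for $i\ne j$, and an *L-matrix* if moreover $b_{i,i}>0$ for all $i$. It is *reducible* if $VBV^T=\begin{pmatrix}B_{1,1}&B_{1,2}\\0&B_{2,2}\end{pmatrix}$ for some permutation matrix $V$, with square diagonal blocks of orders $r$ and $n-r$, $1\le r\le n-1$; otherwise it is *irreducible*. Write $B=D_B-L_B-U_B$ with $D_B$ diagonal and $L_B$, $U_B$ strictly lower and strictly upper triangular. The AOR iteration matrix of $B$ is $$\mathscr L_{\gamma,\omega}(B)=(D_B-\gamma L_B)^{-1}\bigl[(1-\omega)D_B+(\omega-\gamma)L_B+\omega U_B\bigr],$$ and $\rho$ denotes the spectral radius. Let $A=(a_{i,j})\in\mathbb R^{n\times n}$ be an irreducible L-matrix with $a_{i,i}=1$ for all $i$, and let $0<\omega\le1$, $0\le\gamma\le1$. Let $\alpha_{i,j}$ ($1\le i,j\le n$) be real numbers with $\alpha_{i,i}=0$, $\alpha_{i,j}\ge0$ for $i\neq j$, and $\sum_{i\ne j}\alpha_{i,j}a_{i,j}\neq0$. Put $Q_2=(-\alpha_{i,j}a_{i,j})$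 and $A^{(2)}=(I+Q_2)A$, and write $\mathscr L_{\gamma,\omega}=\mathscr L_{\gamma,\omega}(A)$, $\mathscr L^{(2)}_{\gamma,\omega}=\mathscr L_{\gamma,\omega}(A^{(2)})$. For $i\ne j$ put $$e_{i,j}=(1-\alpha_{i,j})a_{i,j}-\sum_{k\ne i,j}\alpha_{i,k}a_{i,k}a_{k,j},$$ and for all $i,j$ put $$\delta_{i,j}=\begin{cases}\sum_{k\neq i}\alpha_{i,k}a_{i,k}a_{k,i}, & i=j,\\ \sum_{i<k<j}\alpha_{i,k}a_{i,k}a_{k,j}, & i<j,\\ \sum_{k<j\text{ or }k>i}\alpha_{i,k}a_{i,k}a_{k,j}, & i>j.\end{cases}$$ Consider the two inequalities * (W) $e_{i,j}\le0$ for all $i\ne j$; * (S) either $A^{(2)}$ is irreducible and $e_{i,j}\le 0$ for all $i\neq j$ with $a_{i,j}<0$, or $e_{i,j}<0$ for all $i\ne j$ with $a_{i,j}<0$. **Theorem.** Suppose that $\sum_{k\ne i}\alpha_{i,k}a_{i,k}a_{k,i}<1$ for $i=1,\dots,n$, and that one of the following conditions (i)–(iv) holds. * (i) $0\le\gamma<1$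 and (S) holds. * (ii) $\gamma=1$, (S) holds, and one of the following holds: * (ii$_1$) $\delta_{i,j}>0$ for some $i,j\in\{1,\dots,n\}$; * (ii$_2$) $a_{n,1}<0$ and $\alpha_{n,1}>0$; * (ii$_3$) $a_{k,k+1}<0$ and $\alpha_{k,k+1}>0$ for some $k\in\{1,\dots,n-1\}$; * (ii$_4$) $\alpha_{i,j}a_{i,j}a_{j,i}>0$ for some $i,j\in\{1,\dots,n\}$; * (ii$_5$) $\alpha_{i,n}a_{i,n}a_{n,j}>0$ for some $i\in\{1,\dots,n-1\}$, $j\in\{1,\dots,i\}$; * (ii$_6$) $\alpha_{i,j}a_{i,j}a_{j,1}>0$ for some $i\in\{1,\dots,n-1\}$, $j\in\{i+1,\dots,n\}$; * (ii$_7$) $\alpha_{i,j}a_{i,j}a_{j,j+1}>0$ for some $i\in\{1,\dots,n\}$, $j\in\{1,\dots,n-1\}$; * (ii$_8$) $\alpha_{i,1}a_{i,1}a_{1,j}>0$ for some $i\in\{2,\dots,n\}$, $j\in\{2,\dots,i\}$; * (ii$_9$) $a_{n,1}<0$ and $a_{k,k+1}<0$ for $k=1,\dots,n-1$. * (iii)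 $0\le\gamma<1$, (W) holds, and for each $i\in\{1,\dots,n-1\}$ there is $j\in\{1,\dots,n\}$ with $\alpha_{i,j}a_{i,j}<0$. * (iv) $\gamma=1$, (W) holds, for each $i\in\{2,\dots,n-1\}$ one of the conditions * (iv$_1$) $\delta_{i,j}>0$ for some $j\in\{1,\dots,n\}$; * (iv$_2$) $a_{i,i+1}<0$ and $\alpha_{i,i+1}>0$; * (iv$_3$) $\alpha_{i,j}a_{i,j}a_{j,i}>0$ for some $j\in\{1,\dots,n\}$; * (iv$_4$) $\alpha_{i,n}a_{i,n}a_{n,j}>0$ for some $j\in\{1,\dots,i\}$; * (iv$_5$) $\alpha_{i,j}a_{i,j}a_{j,1}>0$ for some $j\in\{i+1,\dots,n\}$; * (iv$_6$) $\alpha_{i,j}a_{i,j}a_{j,j+1}>0$ for some $j\in\{1,\dots,n-1\}$; * (iv$_7$) $\alpha_{i,1}a_{i,1}a_{1,j}>0$ for some $j\in\{2,\dots,i\}$ holds, and in addition one of the following holds: * (iv$^a$) $\alpha_{n,k}a_{n,k}a_{k,j}>0$ for some $j\in\{2,\dots,n\}$, $k\in\{1,\dots,j-1\}$; * (iv$^b$)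 $a_{n,1}<0$ and $\alpha_{n,1}>0$; * (iv$^c$) $(1-\alpha_{n,j})a_{n,j}-\sum_{1\le k\le n-1,\,k\neq j}\alpha_{n,k}a_{n,k}a_{k,j}<0$ for some $j\in\{2,\dots,n-1\}$; * (iv$^d$) one of (iv$_1$)–(iv$_6$) holds for $i=1$, and $(1-\alpha_{n,1})a_{n,1}-\sum_{k=2}^{n-1}\alpha_{n,k}a_{n,k}a_{k,1}<0$; * (iv$^e$) one of (iv$_1$)–(iv$_6$) holds for $i=1$, and $a_{n,1}<0$. Then exactly one of the following three relations holds: * (a) $\rho(\mathscr L^{(2)}_{\gamma,\omega})<\rho(\mathscr L_{\gamma,\omega})<1$; * (b) $\rho(\mathscr L^{(2)}_{\gamma,\omega})=\rho(\mathscr L_{\gamma,\omega})=1$; * (c) $\rho(\mathscr L^{(2)}_{\gamma,\omega})>\rho(\mathscr L_{\gamma,\omega})>1$. -/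

import Mathlib

open scoped ENNReal

namespace PrecAOR

/-- Spectral radius of a real square matrix: the largest modulus of its complex eigenvalues. -/
noncomputable def rho {n : ℕ} (T : Matrix (Fin n) (Fin n) ℝ) : ℝ≥0∞ :=
  spectralRadius ℂ (T.map (algebraMap ℝ ℂ))

/-- Z-matrix: nonpositive off-diagonal entries. -/
def IsZMatrix {n : ℕ} (B : Matrix (Fin n) (Fin n) ℝ) : Prop :=
  ∀ i j, i ≠ j → B i j ≤ 0

/-- L-matrix: a Z-matrix with positive diagonal. -/
def IsLMatrix {n : ℕ} (B : Matrix (Fin n) (Fin n) ℝ) : Prop :=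
  IsZMatrix B ∧ ∀ i, 0 < B i i

/-- `B` is reducible if a simultaneous permutation of its rows and columns makes it block upper
triangular, with diagonal blocks of sizes `r` and `n - r`, `1 ≤ r ≤ n - 1`. -/
def IsReducible {n : ℕ} (B : Matrix (Fin n) (Fin n) ℝ) : Prop :=
  ∃ (σ : Equiv.Perm (Fin n)) (r : ℕ), 1 ≤ r ∧ r < n ∧
    ∀ i j : Fin n, r ≤ i.val → j.val < r → B.submatrix σ σ i j = 0

def IsIrreducible {n : ℕ} (B : Matrix (Fin n) (Fin n) ℝ) : Prop :=
  ¬ IsReducible B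

/-! The decomposition `B = D - L - U`. -/

def diagPart {n : ℕ} (B : Matrix (Fin n) (Fin n) ℝ) : Matrix (Fin n) (Fin n) ℝ :=
  Matrix.of fun i j => if i = j then B i j else 0

def lowerPart {n : ℕ} (B : Matrix (Fin n) (Fin n) ℝ) : Matrix (Fin n) (Fin n) ℝ :=
  Matrix.of fun i j => if j < i then -B i j else 0

def upperPart {n : ℕ} (B : Matrix (Fin n) (Fin n) ℝ) : Matrix (Fin n) (Fin n) ℝ :=
  Matrix.of fun i j => if i < j then -B i j else 0

/-- The AOR iteration matrix `(D - γL)⁻¹ [(1-ω)D + (ω-γ)L + ωU]` of `B`. -/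
noncomputable def aor {n : ℕ} (γ ω : ℝ) (B : Matrix (Fin n) (Fin n) ℝ) :
    Matrix (Fin n) (Fin n) ℝ :=
  (diagPart B - γ • lowerPart B)⁻¹ *
    ((1 - ω) • diagPart B + (ω - γ) • lowerPart B + ω • upperPart B)

/-- `Q₂ = (-α_{ij} a_{ij})`. -/
def Q2 {n : ℕ} (α A : Matrix (Fin n) (Fin n) ℝ) : Matrix (Fin n) (Fin n) ℝ :=
  Matrix.of fun i j => -α i j * A i j

/-- The preconditioned matrix `A⁽²⁾ = (I + Q₂) A`. -/
def precond {n : ℕ} (α A : Matrix (Fin n) (Fin n) ℝ) : Matrix (Fin n) (Fin n) ℝ :=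
  (1 + Q2 α A) * A

/-- The parameters admitted in `Q₂`. -/
def Admissible {n : ℕ} (α A : Matrix (Fin n) (Fin n) ℝ) : Prop :=
  (∀ i, α i i = 0) ∧ (∀ i j, i ≠ j → 0 ≤ α i j) ∧
    ∑ i, ∑ j ∈ Finset.univ.filter (fun j => j ≠ i), α i j * A i j ≠ 0

/-- The quantities `δ⁽²⁾_{ij}(γ)`. -/
def delta {n : ℕ} (α A : Matrix (Fin n) (Fin n) ℝ) (γ : ℝ) (i j : Fin n) : ℝ :=
  if i = j then
    ∑ k ∈ Finset.univ.filter (fun k => k ≠ i), α i k * A i k * A k i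
  else if i < j then
    (γ - 1) * (α i j * A i j) +
      γ * ∑ k ∈ Finset.univ.filter (fun k => i < k ∧ k < j), α i k * A i k * A k j
  else
    (γ - 1) * (α i j * A i j) +
      γ * ∑ k ∈ Finset.univ.filter (fun k => k < j ∨ i < k), α i k * A i k * A k j

/-- `(1 - α_{ij}) a_{ij} - ∑_{k ≠ i,j} α_{ik} a_{ik} a_{kj}`. -/
def offDiagExpr {n : ℕ} (α A : Matrix (Fin n) (Fin n) ℝ) (i j : Fin n) : ℝ :=
  (1 - α i j) * A i j -
    ∑ k ∈ Finset.univ.filter (fun k => k ≠ i ∧ k ≠ j), α i k * A i k * A k j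

/-- The weak inequality: `offDiagExpr ≤ 0` at all off-diagonal positions. -/
def WeakIneq {n : ℕ} (α A : Matrix (Fin n) (Fin n) ℝ) : Prop :=
  ∀ i j, i ≠ j → offDiagExpr α A i j ≤ 0

/-- The inequality `offDiagExpr ≲ 0` at the off-diagonal positions where `a_{ij} < 0`:
`≲` is `≤` provided that the preconditioned matrix is irreducible, and `<` otherwise. -/
def StrictTypeIneq {n : ℕ} (α A : Matrix (Fin n) (Fin n) ℝ) : Prop :=
  (IsIrreducible (precond α A) ∧ ∀ i j, i ≠ j → A i j < 0 → offDiagExpr α A i j ≤ 0) ∨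
    ∀ i j, i ≠ j → A i j < 0 → offDiagExpr α A i j < 0

/-! From here on the order is `n = m + 1`; the row and column indices `1, …, n` of the mathematical
text are the elements `0, …, Fin.last m` of `Fin (m + 1)`, and for `k : Fin m` the pair
`(k.castSucc, k.succ)` is a pair of consecutive indices. -/

/-- The nine alternatives (ii₁)–(ii₉). -/
def CondII {m : ℕ} (α A : Matrix (Fin (m + 1)) (Fin (m + 1)) ℝ) : Prop :=
  (∃ i j, 0 < delta α A 1 i j) ∨
  (A (Fin.last m) 0 < 0 ∧ 0 < α (Fin.last m) 0) ∨
  (∃ k : Fin m, A k.castSucc k.succ < 0 ∧ 0 < α k.castSucc k.succ) ∨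
  (∃ i j, 0 < α i j * A i j * A j i) ∨
  (∃ i j, i < Fin.last m ∧ j ≤ i ∧ 0 < α i (Fin.last m) * A i (Fin.last m) * A (Fin.last m) j) ∨
  (∃ i j, i < Fin.last m ∧ i < j ∧ 0 < α i j * A i j * A j 0) ∨
  (∃ (i : Fin (m + 1)) (k : Fin m), 0 < α i k.castSucc * A i k.castSucc * A k.castSucc k.succ) ∨
  (∃ i j, 0 < i ∧ 0 < j ∧ j ≤ i ∧ 0 < α i 0 * A i 0 * A 0 j) ∨
  (A (Fin.last m) 0 < 0 ∧ ∀ k : Fin m, A k.castSucc k.succ < 0)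

/-- The row alternatives (iv₁)–(iv₆) for the row `i`. -/
def RowCond16 {m : ℕ} (α A : Matrix (Fin (m + 1)) (Fin (m + 1)) ℝ) (i : Fin (m + 1)) : Prop :=
  (∃ j, 0 < delta α A 1 i j) ∨
  (∃ k : Fin m, k.castSucc = i ∧ A i k.succ < 0 ∧ 0 < α i k.succ) ∨
  (∃ j, 0 < α i j * A i j * A j i) ∨
  (∃ j, j ≤ i ∧ 0 < α i (Fin.last m) * A i (Fin.last m) * A (Fin.last m) j) ∨
  (∃ j, i < j ∧ 0 < α i j * A i j * A j 0) ∨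
  (∃ k : Fin m, 0 < α i k.castSucc * A i k.castSucc * A k.castSucc k.succ)

/-- The row alternatives (iv₁)–(iv₇) for the row `i`. -/
def RowCond17 {m : ℕ} (α A : Matrix (Fin (m + 1)) (Fin (m + 1)) ℝ) (i : Fin (m + 1)) : Prop :=
  RowCond16 α A i ∨ ∃ j, 0 < j ∧ j ≤ i ∧ 0 < α i 0 * A i 0 * A 0 j

/-- The alternatives (ivᵃ)–(ivᵉ) about the last row. -/
def LastRowCond {m : ℕ} (α A : Matrix (Fin (m + 1)) (Fin (m + 1)) ℝ) : Prop :=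
  (∃ j k, 0 < j ∧ k < j ∧ 0 < α (Fin.last m) k * A (Fin.last m) k * A k j) ∨
  (A (Fin.last m) 0 < 0 ∧ 0 < α (Fin.last m) 0) ∨
  (∃ j, 0 < j ∧ j < Fin.last m ∧
    (1 - α (Fin.last m) j) * A (Fin.last m) j -
      ∑ k ∈ Finset.univ.filter (fun k => k < Fin.last m ∧ k ≠ j),
        α (Fin.last m) k * A (Fin.last m) k * A k j < 0) ∨
  (RowCond16 α A 0 ∧
    (1 - α (Fin.last m) 0) * A (Fin.last m) 0 -
      ∑ k ∈ Finset.univ.filter (fun k => 0 < k ∧ k < Fin.last m),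
        α (Fin.last m) k * A (Fin.last m) k * A k 0 < 0) ∨
  (RowCond16 α A 0 ∧ A (Fin.last m) 0 < 0)

/-- The list of alternative conditions (i)–(iv). -/
def Conditions {m : ℕ} (α A : Matrix (Fin (m + 1)) (Fin (m + 1)) ℝ) (γ : ℝ) : Prop :=
  (γ < 1 ∧ StrictTypeIneq α A) ∨
  (γ = 1 ∧ StrictTypeIneq α A ∧ CondII α A) ∨
  (γ < 1 ∧ WeakIneq α A ∧ ∀ i, i < Fin.last m → ∃ j, α i j * A i j < 0) ∨
  (γ = 1 ∧ WeakIneq α A ∧ (∀ i, 0 < i → i < Fin.last m → RowCond17 α A i) ∧ LastRowCond α A)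

/-- Exactly one of three propositions holds. -/
def ExactlyOne (p q r : Prop) : Prop :=
  (p ∨ q ∨ r) ∧ ¬(p ∧ q) ∧ ¬(p ∧ r) ∧ ¬(q ∧ r)

end PrecAOR

/-! Write B = D - L - U, M = D - γL and N = (1-γ)L + U. Then `aor γ ω B` = (1-ω)I + ω M⁻¹N is
nonnegative, and its Perron root is 1-ω+ωr with r the Perron root of M⁻¹N. Since ω > 0, comparing
spectral radii with each other and with 1 amounts to comparing the roots r with each other and with
1. An eigenvector for r is a null vector of rM - N, which is B with its entries multiplied by t =
1-γ+γr below the diagonal, r on it and 1 above it (`weight`).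

Let r belong to A, with right vector x > 0, and s to A⁽²⁾, with left null vector y ≥ 0 and v = yM ≥
0, v ≠ 0. Evaluating y(rM - N)x for A⁽²⁾ in two ways gives (r - s)(v·x) = (1 - r)(y·g), which is
`perron_root_sub_mul`. On the left, y annihilates sM - N. On the right, x annihilates the weighted
A, so only the Q₂A term survives; every weight equals 1 at r = 1, which is where the factor 1 - r
comes from. The vector g is `gap`, and it is nonnegative.

As v·x > 0, the trichotomy follows once y·g > 0. This is needed only for s > 0. In that case the
support of y is closed under the edges of A⁽²⁾ and has at least two points, and each of (i)–(iv)
makes g positive somewhere on such a set (`Conditions.exists_gap_pos`). -/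

namespace PrecAOR

/-! ### Perron–Frobenius theory by the Collatz–Wielandt extremal principle. -/

section PerronFrobenius

variable {ι : Type*} [Fintype ι]

open Matrix

/-- A nonzero nonnegative vector, normalized to lie in the standard simplex. -/
lemma exists_smul_mem_stdSimplex {y : ι → ℝ} (hy : ∀ i, 0 ≤ y i) (hy0 : y ≠ 0) :
    ∃ a : ℝ, 0 < a ∧ a • y ∈ stdSimplex ℝ ι := by
  have hpos : 0 < ∑ i, y i := by
    obtain ⟨i, hi⟩ := Function.ne_iff.1 hy0
    exact Finset.sum_pos' (fun i _ => hy i) ⟨i, Finset.mem_univ i, lt_of_le_of_ne (hy i) (Ne.symm hi)⟩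
  refine ⟨(∑ i, y i)⁻¹, inv_pos.2 hpos, fun i => ?_, ?_⟩
  · exact mul_nonneg (inv_pos.2 hpos).le (hy i)
  · simp only [Pi.smul_apply, smul_eq_mul, ← Finset.mul_sum]
    exact inv_mul_cancel₀ hpos.ne'

lemma le_sum_entries_of_smul_le_mulVec {T : Matrix ι ι ℝ} (hT : ∀ i j, 0 ≤ T i j) {x : ι → ℝ}
    (hx : x ∈ stdSimplex ℝ ι) {c : ℝ} (h : ∀ i, c * x i ≤ (T *ᵥ x) i) :
    c ≤ ∑ i, ∑ j, T i j := by
  calc c = ∑ i, c * x i := by rw [← Finset.mul_sum, hx.2, mul_one]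
    _ ≤ ∑ i, (T *ᵥ x) i := Finset.sum_le_sum fun i _ => h i
    _ ≤ ∑ i, ∑ j, T i j := by
      refine Finset.sum_le_sum fun i _ => Finset.sum_le_sum fun j _ => ?_
      have : x j ≤ 1 := hx.2 ▸ Finset.single_le_sum (fun k _ => hx.1 k) (Finset.mem_univ j)
      exact mul_le_of_le_one_right (hT i j) this

/-- Perron's theorem for matrices with positive entries, together with the extremal property of the
Perron root. -/
lemma exists_perron_of_pos [Nonempty ι] {T : Matrix ι ι ℝ} (hT : ∀ i j, 0 < T i j) :
    ∃ r : ℝ, 0 ≤ r ∧ ∃ x ∈ stdSimplex ℝ ι, T *ᵥ x = r • x ∧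
      ∀ (c : ℝ) (y : ι → ℝ), (∀ i, 0 ≤ y i) → y ≠ 0 → (∀ i, c * y i ≤ (T *ᵥ y) i) → c ≤ r := by
  classical
  have hT0 : ∀ i j, 0 ≤ T i j := fun i j => (hT i j).le
  set B := ∑ i, ∑ j, T i j
  have hB0 : 0 ≤ B := Finset.sum_nonneg fun i _ => Finset.sum_nonneg fun j _ => hT0 i j
  -- Pairs (c, x) with cx ≤ Tx and x in the simplex. The bound c ≤ B costs nothing by
  -- `le_sum_entries_of_smul_le_mulVec`, and compactness yields a largest c.
  let K : Set (ℝ × (ι → ℝ)) :=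
    (Set.Icc 0 B ×ˢ stdSimplex ℝ ι) ∩ {p | ∀ i, p.1 * p.2 i ≤ (T *ᵥ p.2) i}
  have hK : IsCompact K := by
    refine (isCompact_Icc.prod (isCompact_stdSimplex ℝ ι)).inter_right ?_
    simp only [Set.ofPred_forall]
    refine isClosed_iInter fun i => isClosed_le (by fun_prop) ?_
    simp only [mulVec, dotProduct]
    fun_prop
  have hKne : K.Nonempty := by
    obtain ⟨i⟩ := ‹Nonempty ι›
    refine ⟨(0, Pi.single i 1), ⟨⟨⟨le_rfl, hB0⟩, single_mem_stdSimplex ℝ i⟩, fun k => ?_⟩⟩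
    simpa using hT0 k i
  obtain ⟨⟨r, x⟩, ⟨⟨⟨hr0, -⟩, hx⟩, hrx⟩, hmax⟩ := hK.exists_isMaxOn hKne continuous_fst.continuousOn
  have hext : ∀ (c : ℝ) (y : ι → ℝ), (∀ i, 0 ≤ y i) → y ≠ 0 →
      (∀ i, c * y i ≤ (T *ᵥ y) i) → c ≤ r := by
    intro c y hy hy0 hc
    rcases lt_or_ge c 0 with hneg | hc0
    · exact hneg.le.trans hr0
    obtain ⟨a, ha, hay⟩ := exists_smul_mem_stdSimplex hy hy0
    have hc' : ∀ i, c * (a • y) i ≤ (T *ᵥ (a • y)) i := by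
      intro i
      rw [mulVec_smul]
      simp only [Pi.smul_apply, smul_eq_mul]
      nlinarith [hc i]
    exact hmax (a := (c, a • y))
      ⟨⟨⟨hc0, le_sum_entries_of_smul_le_mulVec hT0 hay hc'⟩, hay⟩, hc'⟩
  refine ⟨r, hr0, x, hx, ?_, hext⟩
  -- If Tx - rx is nonzero, then T(Tx - rx) > 0 entrywise, so the vector Tx admits a constant larger
  -- than r, namely its least quotient, against maximality.
  by_contra hne
  have hmv : ∀ z : ι → ℝ, (∀ i, 0 ≤ z i) → z ≠ 0 → ∀ i, 0 < (T *ᵥ z) i := by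
    intro z hz hz0 i
    obtain ⟨j, hj⟩ := Function.ne_iff.1 hz0
    exact Finset.sum_pos' (fun k _ => mul_nonneg (hT0 i k) (hz k))
      ⟨j, Finset.mem_univ j, mul_pos (hT i j) (lt_of_le_of_ne (hz j) (Ne.symm hj))⟩
  have hx0 : x ≠ 0 := by
    rintro rfl
    simpa using hx.2
  have hz := hmv (T *ᵥ x - r • x) (fun i => sub_nonneg.2 (hrx i)) (sub_ne_zero.2 hne)
  have hy := hmv x hx.1 hx0
  obtain ⟨i, -, hi⟩ := Finset.exists_min_image Finset.univ
    (fun i => (T *ᵥ (T *ᵥ x)) i / (T *ᵥ x) i) Finset.univ_nonempty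
  have hle := hext ((T *ᵥ (T *ᵥ x)) i / (T *ᵥ x) i) (T *ᵥ x) (fun i => (hy i).le)
    (fun h => (hy i).ne' (congrFun h i)) (fun j => by
      have := hi j (Finset.mem_univ j)
      rwa [le_div_iff₀ (hy j)] at this)
  rw [div_le_iff₀ (hy i)] at hle
  have := hz i
  rw [mulVec_sub, mulVec_smul] at this
  simp only [Pi.sub_apply, Pi.smul_apply, smul_eq_mul] at this
  linarith

/-- The Perron–Frobenius theorem for nonnegative matrices, together with the extremal property of
the Perron root. -/
lemma exists_perron_of_nonneg [Nonempty ι] {T : Matrix ι ι ℝ} (hT : ∀ i j, 0 ≤ T i j) :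
    ∃ r : ℝ, 0 ≤ r ∧ ∃ x ∈ stdSimplex ℝ ι, T *ᵥ x = r • x ∧
      ∀ (c : ℝ) (y : ι → ℝ), (∀ i, 0 ≤ y i) → y ≠ 0 → (∀ i, c * y i ≤ (T *ᵥ y) i) → c ≤ r := by
  -- Positive perturbations with ε = 1/(k+1); a subsequence of their Perron pairs converges. The
  -- extremal property passes to the limit because Ty ≤ `S ε` y for y ≥ 0.
  let S : ℝ → Matrix ι ι ℝ := fun ε => Matrix.of fun i j => T i j + ε
  have hS : ∀ k : ℕ, ∀ i j, 0 < S (1 / ((k : ℝ) + 1)) i j := fun k i j =>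
    add_pos_of_nonneg_of_pos (hT i j) Nat.one_div_pos_of_nat
  choose r hr x hx hrx hext using fun k => exists_perron_of_pos (hS k)
  have hbd : ∀ k, r k ≤ ∑ i, ∑ j, (T i j + 1) := by
    intro k
    refine (le_sum_entries_of_smul_le_mulVec (fun i j => (hS k i j).le) (hx k)
      fun i => (congrFun (hrx k) i).ge).trans ?_
    refine Finset.sum_le_sum fun i _ => Finset.sum_le_sum fun j _ => ?_
    have : 1 / ((k : ℝ) + 1) ≤ 1 := by
      rw [div_le_one (by positivity)]
      linarith [(Nat.cast_nonneg k : (0 : ℝ) ≤ k)]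
    simpa [S] using this
  obtain ⟨⟨r', x'⟩, ⟨hr', hx'⟩, φ, hφ, hlim⟩ :=
    ((isCompact_Icc (a := (0 : ℝ)) (b := ∑ i, ∑ j, (T i j + 1))).prod
      (isCompact_stdSimplex ℝ ι)).tendsto_subseq (x := fun k => (r k, x k))
      (fun k => ⟨⟨hr k, hbd k⟩, hx k⟩)
  have hlr : Filter.Tendsto (fun k => r (φ k)) Filter.atTop (nhds r') :=
    (continuous_fst.tendsto _).comp hlim
  have hlx : Filter.Tendsto (fun k => x (φ k)) Filter.atTop (nhds x') :=
    (continuous_snd.tendsto _).comp hlim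
  have hle : Filter.Tendsto (fun k => 1 / ((φ k : ℝ) + 1)) Filter.atTop (nhds 0) :=
    tendsto_one_div_add_atTop_nhds_zero_nat.comp hφ.tendsto_atTop
  refine ⟨r', hr'.1, x', hx', ?_, ?_⟩
  · have hcont : Continuous fun p : ℝ × (ι → ℝ) => S p.1 *ᵥ p.2 := by
      refine continuous_pi fun i => ?_
      simp only [mulVec, dotProduct, S, Matrix.of_apply]
      fun_prop
    have h1 : Filter.Tendsto (fun k => S (1 / ((φ k : ℝ) + 1)) *ᵥ x (φ k)) Filter.atTop
        (nhds (S 0 *ᵥ x')) :=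
      Filter.Tendsto.comp (f := fun k => (1 / ((φ k : ℝ) + 1), x (φ k))) (hcont.tendsto (0, x'))
        (hle.prodMk_nhds hlx)
    have h2 : Filter.Tendsto (fun k => S (1 / ((φ k : ℝ) + 1)) *ᵥ x (φ k)) Filter.atTop
        (nhds (r' • x')) := by
      simp only [hrx]
      exact hlr.smul hlx
    have h0 : S 0 = T := by ext i j; simp [S]
    rw [← h0]
    exact tendsto_nhds_unique h1 h2
  · intro c y hy hy0 hc
    refine ge_of_tendsto' hlr fun k => hext (φ k) c y hy hy0 fun i => (hc i).trans ?_
    refine Finset.sum_le_sum fun j _ => mul_le_mul_of_nonneg_right ?_ (hy j)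
    simp only [S, Matrix.of_apply]
    linarith [(Nat.one_div_pos_of_nat (n := φ k) : (0 : ℝ) < 1 / ((φ k : ℝ) + 1))]

end PerronFrobenius

open Matrix

variable {n : ℕ}

/-! ### The spectral radius as a Perron root. -/

lemma rho_transpose (T : Matrix (Fin n) (Fin n) ℝ) : rho Tᵀ = rho T := by
  have : spectrum ℂ (Tᵀ.map (algebraMap ℝ ℂ)) = spectrum ℂ (T.map (algebraMap ℝ ℂ)) := by
    ext z
    rw [Matrix.mem_spectrum_iff_isRoot_charpoly, Matrix.mem_spectrum_iff_isRoot_charpoly,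
      Matrix.transpose_map, Matrix.charpoly_transpose]
  simp only [rho, spectralRadius, this]

/-- A root with the extremal property of the Perron root is the spectral radius. -/
lemma rho_eq_ofReal {T : Matrix (Fin n) (Fin n) ℝ} (hT : ∀ i j, 0 ≤ T i j) {r : ℝ} (hr : 0 ≤ r)
    {x : Fin n → ℝ} (hx0 : x ≠ 0) (hx : T *ᵥ x = r • x)
    (hext : ∀ (c : ℝ) (y : Fin n → ℝ), (∀ i, 0 ≤ y i) → y ≠ 0 →
      (∀ i, c * y i ≤ (T *ᵥ y) i) → c ≤ r) :
    rho T = ENNReal.ofReal r := by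
  have hspec : ∀ z : ℂ, z ∈ spectrum ℂ (T.map (algebraMap ℝ ℂ)) ↔
      ∃ u : Fin n → ℂ, u ≠ 0 ∧ T.map (algebraMap ℝ ℂ) *ᵥ u = z • u := by
    intro z
    rw [← Matrix.spectrum_toLin', ← Module.End.hasEigenvalue_iff_mem_spectrum]
    constructor
    · intro h
      obtain ⟨u, hu⟩ := h.exists_hasEigenvector
      exact ⟨u, hu.2, by simpa using hu.apply_eq_smul⟩
    · rintro ⟨u, hu0, hu⟩
      exact Module.End.hasEigenvalue_of_hasEigenvector
        (x := u) ⟨Module.End.mem_eigenspace_iff.2 (by simpa using hu), hu0⟩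
  apply le_antisymm
  · refine iSup₂_le fun z hz => ?_
    obtain ⟨u, hu0, hu⟩ := (hspec z).1 hz
    have hle : ‖z‖ ≤ r := by
      -- The moduli of the entries of an eigenvector satisfy |z||u| ≤ T|u|.
      refine hext ‖z‖ (fun i => ‖u i‖) (fun i => norm_nonneg _) ?_ fun i => ?_
      · intro h
        exact hu0 (funext fun i => norm_eq_zero.1 (congrFun h i))
      · rw [← norm_mul]
        have := congrFun hu i
        simp only [Pi.smul_apply, smul_eq_mul] at this
        rw [← this, mulVec, dotProduct]
        refine (norm_sum_le _ _).trans (Finset.sum_le_sum fun j _ => ?_)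
        simp [abs_of_nonneg (hT i j)]
    rw [ENNReal.ofReal, ENNReal.coe_le_coe]
    exact NNReal.coe_le_coe.1 (hle.trans (Real.le_coe_toNNReal r))
  · have hmem : (r : ℂ) ∈ spectrum ℂ (T.map (algebraMap ℝ ℂ)) := by
      refine (hspec _).2 ⟨fun i => (x i : ℂ), ?_, ?_⟩
      · intro h
        exact hx0 (funext fun i => by simpa using congrFun h i)
      · funext i
        have := congrArg (fun a : ℝ => (a : ℂ)) (congrFun hx i)
        simpa [mulVec, dotProduct] using this
    have : ENNReal.ofReal r = (‖(r : ℂ)‖₊ : ℝ≥0∞) := by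
      rw [ENNReal.ofReal, ENNReal.coe_inj]
      ext
      simp [abs_of_nonneg hr, hr]
    rw [this]
    exact le_iSup₂ (f := fun (z : ℂ) (_ : z ∈ spectrum ℂ (T.map (algebraMap ℝ ℂ))) =>
      (‖z‖₊ : ℝ≥0∞)) _ hmem

/-- The spectral radius of a nonnegative matrix is an eigenvalue with nonnegative right and left
eigenvectors. -/
theorem exists_nonneg_eigenvectors {m : ℕ} {T : Matrix (Fin (m + 1)) (Fin (m + 1)) ℝ}
    (hT : ∀ i j, 0 ≤ T i j) :
    ∃ r : ℝ, 0 ≤ r ∧ rho T = ENNReal.ofReal r ∧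
      (∃ x : Fin (m + 1) → ℝ, (∀ i, 0 ≤ x i) ∧ x ≠ 0 ∧ T *ᵥ x = r • x) ∧
      ∃ v : Fin (m + 1) → ℝ, (∀ i, 0 ≤ v i) ∧ v ≠ 0 ∧ v ᵥ* T = r • v := by
  have hne : ∀ x ∈ stdSimplex ℝ (Fin (m + 1)), x ≠ 0 := by
    rintro x hx rfl
    simpa using hx.2
  obtain ⟨r, hr, x, hx, hrx, hext⟩ := exists_perron_of_nonneg hT
  obtain ⟨s, hs, v, hv, hsv, hext'⟩ := exists_perron_of_nonneg (T := Tᵀ) fun i j => hT j i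
  have h1 := rho_eq_ofReal hT hr (hne x hx) hrx hext
  have h2 := rho_eq_ofReal (T := Tᵀ) (fun i j => hT j i) hs (hne v hv) hsv hext'
  rw [rho_transpose, h1, ENNReal.ofReal_eq_ofReal_iff hr hs] at h2
  subst h2
  exact ⟨r, hr, h1, ⟨x, hx.1, hne x hx, hrx⟩, v, hv.1, hne v hv, by rw [← mulVec_transpose, hsv]⟩

/-! ### Irreducibility through closed sets of indices. -/

section Irreducible

/-- A nonempty set of indices that no nonzero entry of an irreducible matrix leaves is everything. -/
lemma IsIrreducible.mem_of_closed {B : Matrix (Fin n) (Fin n) ℝ} (hB : IsIrreducible B)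
    {p : Fin n → Prop} (hne : ∃ i, p i) (hcl : ∀ i j, p i → B i j ≠ 0 → p j) (i : Fin n) : p i := by
  classical
  by_contra hi
  apply hB
  obtain ⟨k, hk⟩ := hne
  have hcard : Fintype.card {j : Fin n // ¬ p j} < n := by
    simpa using Fintype.card_subtype_lt (p := fun j => ¬ p j) (x := k) (by simpa using hk)
  have hpos : 0 < Fintype.card {j : Fin n // ¬ p j} := Fintype.card_pos_iff.2 ⟨⟨i, hi⟩⟩
  have he : Fintype.card {j : Fin n // j.val < Fintype.card {j : Fin n // ¬ p j}} =
      Fintype.card {j : Fin n // ¬ p j} := by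
    rw [Fintype.card_subtype, Fin.card_filter_val_lt, min_eq_right hcard.le]
  let e := Fintype.equivOfCardEq he
  -- The permutation lists the complement of `p` first, so the block required to vanish consists of
  -- the entries leading out of `p`.
  refine ⟨e.extendSubtype, _, hpos, hcard, fun a b ha hb => ?_⟩
  have h1 : p (e.extendSubtype a) := by
    simpa using e.extendSubtype_not_mem a (by simpa using ha)
  have h2 : ¬ p (e.extendSubtype b) := e.extendSubtype_mem b hb
  by_contra h
  exact h2 (hcl _ _ h1 h)

lemma IsIrreducible.of_support {A B : Matrix (Fin n) (Fin n) ℝ} (hA : IsIrreducible A)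
    (h : ∀ i j, i ≠ j → A i j ≠ 0 → B i j ≠ 0) : IsIrreducible B := by
  rintro ⟨σ, r, h1, h2, h3⟩
  refine hA ⟨σ, r, h1, h2, fun i j hi hj => ?_⟩
  by_contra hne
  refine h _ _ ?_ hne (h3 i j hi hj)
  rintro heq
  rw [σ.injective heq] at hi
  exact absurd hj (not_lt.2 hi)

lemma IsIrreducible.exists_ne_zero {m : ℕ} (hm : m ≠ 0)
    {B : Matrix (Fin (m + 1)) (Fin (m + 1)) ℝ} (hB : IsIrreducible B) (i : Fin (m + 1)) :
    ∃ j, j ≠ i ∧ B i j ≠ 0 := by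
  by_contra! h
  have : Nontrivial (Fin (m + 1)) := Fin.nontrivial_iff_two_le.2 (by omega)
  obtain ⟨k, hk⟩ := exists_ne i
  refine hk (hB.mem_of_closed (p := fun j => j = i) ⟨i, rfl⟩ ?_ k)
  rintro a j rfl hj
  by_contra hne
  exact hj (h j hne)

end Irreducible

/-! ### The AOR splitting and its Perron vectors. -/

section Splitting

/-- The entries of `r D - t L - U`, relative to those of `D - L - U`. -/
def weight (t r : ℝ) (i j : Fin n) : ℝ :=
  if j < i then t else if i = j then r else 1

lemma weight_of_lt {t r : ℝ} {i j : Fin n} (h : j < i) : weight t r i j = t := by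
  simp [weight, h]

lemma weight_self {t r : ℝ} {i : Fin n} : weight t r i i = r := by
  simp [weight]

lemma weight_of_gt {t r : ℝ} {i j : Fin n} (h : i < j) : weight t r i j = 1 := by
  simp [weight, h.not_gt, h.ne]

lemma weight_nonneg {t r : ℝ} (ht : 0 ≤ t) (hr : 0 ≤ r) (i j : Fin n) : 0 ≤ weight t r i j := by
  unfold weight
  split_ifs <;> first | assumption | exact zero_le_one

lemma weight_pos {t r : ℝ} (ht : 0 < t) (hr : 0 < r) (i j : Fin n) : 0 < weight t r i j := by
  unfold weight
  split_ifs <;> first | assumption | exact zero_lt_one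

lemma vecMul_nonneg {v : Fin n → ℝ} {T : Matrix (Fin n) (Fin n) ℝ} (hv : ∀ i, 0 ≤ v i)
    (hT : ∀ i j, 0 ≤ T i j) (j : Fin n) : 0 ≤ (v ᵥ* T) j := by
  simp only [vecMul, dotProduct]
  exact Finset.sum_nonneg fun i _ => mul_nonneg (hv i) (hT i j)

/-- The matrix `D - γ L` inverted by the AOR method. -/
def aorLower (γ : ℝ) (B : Matrix (Fin n) (Fin n) ℝ) : Matrix (Fin n) (Fin n) ℝ :=
  diagPart B - γ • lowerPart B

/-- The matrix `(1 - γ) L + U`. -/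
def aorUpper (γ : ℝ) (B : Matrix (Fin n) (Fin n) ℝ) : Matrix (Fin n) (Fin n) ℝ :=
  (1 - γ) • lowerPart B + upperPart B

variable {γ ω : ℝ} {B : Matrix (Fin n) (Fin n) ℝ}

lemma aorLower_apply (i j : Fin n) :
    aorLower γ B i j = if j < i then γ * B i j else if i = j then B i j else 0 := by
  rcases lt_trichotomy i j with h | rfl | h
  · simp [aorLower, diagPart, lowerPart, h.not_gt, h.ne]
  · simp [aorLower, diagPart, lowerPart]
  · simp [aorLower, diagPart, lowerPart, h, h.ne']

lemma aorUpper_nonneg (hγ1 : γ ≤ 1) (hB : IsZMatrix B) (i j : Fin n) : 0 ≤ aorUpper γ B i j := by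
  rcases lt_trichotomy i j with h | rfl | h
  · simpa [aorUpper, lowerPart, upperPart, h, h.not_gt] using hB i j h.ne
  · simp [aorUpper, lowerPart, upperPart]
  · simpa [aorUpper, lowerPart, upperPart, h, h.not_gt] using
      mul_nonpos_of_nonneg_of_nonpos (sub_nonneg.2 hγ1) (hB i j h.ne')

/-- This turns the eigenvalue equation Nx = rMx into a null vector equation for a reweighted B.
Below the diagonal the weights γr and 1-γ add up. -/
lemma smul_aorLower_sub_aorUpper (r : ℝ) (i j : Fin n) :
    r * aorLower γ B i j - aorUpper γ B i j = weight (1 - γ + γ * r) r i j * B i j := by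
  rw [aorLower_apply]
  rcases lt_trichotomy i j with h | rfl | h
  · simp [aorUpper, lowerPart, upperPart, h, h.not_gt, h.ne, weight_of_gt]
  · simp [aorUpper, lowerPart, upperPart, weight_self]
  · simp [aorUpper, lowerPart, upperPart, h, h.not_gt, weight_of_lt]
    ring

lemma isUnit_det_aorLower (hB : ∀ i, 0 < B i i) : IsUnit (aorLower γ B).det := by
  have htri : (aorLower γ B).BlockTriangular OrderDual.toDual := by
    intro i j hij
    have hij : i < j := hij
    simp [aorLower_apply, hij.not_gt, hij.ne]
  rw [Matrix.det_of_isLowerTriangular _ htri, isUnit_iff_ne_zero]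
  refine Finset.prod_ne_zero_iff.2 fun i _ => ?_
  simpa [aorLower_apply] using (hB i).ne'

/-- Forward substitution: the strictly lower entries are nonpositive, so nonnegativity of the
earlier coordinates passes to the next one. -/
lemma nonneg_of_aorLower_mulVec_nonneg (hγ : 0 ≤ γ) (hB : IsLMatrix B) {u : Fin n → ℝ}
    (hu : ∀ i, 0 ≤ (aorLower γ B *ᵥ u) i) (i : Fin n) : 0 ≤ u i := by
  induction i using WellFoundedLT.induction with
  | ind i ih =>
    have h := hu i
    rw [mulVec, dotProduct, ← Finset.add_sum_erase _ _ (Finset.mem_univ i)] at h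
    have hrest : ∑ j ∈ Finset.univ.erase i, aorLower γ B i j * u j ≤ 0 := by
      refine Finset.sum_nonpos fun j hj => ?_
      rw [aorLower_apply]
      have hne := Finset.ne_of_mem_erase hj
      split_ifs with h1 h2
      · exact mul_nonpos_of_nonpos_of_nonneg
          (mul_nonpos_of_nonneg_of_nonpos hγ (hB.1 i j hne.symm)) (ih j h1)
      · exact absurd h2.symm hne
      · simp
    have hd : aorLower γ B i i = B i i := by simp [aorLower_apply]
    rw [hd] at h
    exact nonneg_of_mul_nonneg_right (by linarith) (hB.2 i)

lemma aorLower_inv_nonneg (hγ : 0 ≤ γ) (hB : IsLMatrix B) (i j : Fin n) :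
    0 ≤ (aorLower γ B)⁻¹ i j := by
  refine nonneg_of_aorLower_mulVec_nonneg (u := fun i => (aorLower γ B)⁻¹ i j) hγ hB (fun k => ?_) i
  have : (aorLower γ B * (aorLower γ B)⁻¹) k j = (1 : Matrix (Fin n) (Fin n) ℝ) k j := by
    rw [Matrix.mul_nonsing_inv _ (isUnit_det_aorLower hB.2)]
  change 0 ≤ (aorLower γ B * (aorLower γ B)⁻¹) k j
  rw [this, Matrix.one_apply]
  split_ifs <;> norm_num

lemma aorLower_mul_aor (hB : ∀ i, 0 < B i i) :
    aorLower γ B * aor γ ω B = (1 - ω) • aorLower γ B + ω • aorUpper γ B := by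
  rw [aor, ← aorLower, Matrix.mul_nonsing_inv_cancel_left _ _ (isUnit_det_aorLower hB)]
  simp only [aorLower, aorUpper]
  module

lemma aor_nonneg (hω : 0 ≤ ω) (hω1 : ω ≤ 1) (hγ : 0 ≤ γ) (hγ1 : γ ≤ 1) (hB : IsLMatrix B)
    (i j : Fin n) : 0 ≤ aor γ ω B i j := by
  have hu := isUnit_det_aorLower (γ := γ) hB.2
  have h : aor γ ω B = (1 - ω) • 1 + ω • ((aorLower γ B)⁻¹ * aorUpper γ B) := by
    rw [← Matrix.nonsing_inv_mul_cancel_left _ (aor γ ω B) hu, aorLower_mul_aor hB.2,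
      Matrix.mul_add, Matrix.mul_smul, Matrix.mul_smul, Matrix.nonsing_inv_mul _ hu]
  rw [h]
  refine add_nonneg (mul_nonneg (sub_nonneg.2 hω1) ?_) (mul_nonneg hω ?_)
  · rw [Matrix.one_apply]
    split_ifs <;> norm_num
  · rw [Matrix.mul_apply]
    exact Finset.sum_nonneg fun k _ =>
      mul_nonneg (aorLower_inv_nonneg hγ hB i k) (aorUpper_nonneg hγ1 hB.1 k j)

/-- Perron vectors of the AOR iteration matrix of an L-matrix `B = D - L - U`, written as null
vectors of `r D - (1 - γ + γ r) L - U`. -/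
theorem exists_aor_perron {m : ℕ} {B : Matrix (Fin (m + 1)) (Fin (m + 1)) ℝ} (hω : 0 < ω)
    (hω1 : ω ≤ 1) (hγ : 0 ≤ γ) (hγ1 : γ ≤ 1) (hB : IsLMatrix B) :
    ∃ r : ℝ, 0 ≤ r ∧ rho (aor γ ω B) = ENNReal.ofReal (1 - ω + ω * r) ∧
      (∃ x : Fin (m + 1) → ℝ, (∀ i, 0 ≤ x i) ∧ x ≠ 0 ∧
        ∀ i, ∑ j, weight (1 - γ + γ * r) r i j * B i j * x j = 0) ∧
      ∃ y : Fin (m + 1) → ℝ, (∀ i, 0 ≤ y i) ∧ (∀ j, 0 ≤ (y ᵥ* aorLower γ B) j) ∧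
        y ᵥ* aorLower γ B ≠ 0 ∧
        ∀ j, ∑ i, y i * (weight (1 - γ + γ * r) r i j * B i j) = 0 := by
  obtain ⟨R, -, hR, ⟨x, hx, hx0, hRx⟩, v, hv, hv0, hRv⟩ :=
    exists_nonneg_eigenvectors (aor_nonneg hω.le hω1 hγ hγ1 hB)
  have hu := isUnit_det_aorLower (γ := γ) hB.2
  have hM := aorLower_mul_aor (γ := γ) (ω := ω) hB.2
  obtain ⟨r, hr⟩ : ∃ r, R = 1 - ω + ω * r := ⟨(R - (1 - ω)) / ω, by field_simp; ring⟩
  set y := v ᵥ* (aorLower γ B)⁻¹ with hy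
  have hyv : y ᵥ* aorLower γ B = v := by
    rw [hy, vecMul_vecMul, Matrix.nonsing_inv_mul _ hu, vecMul_one]
  have hy0 : ∀ i, 0 ≤ y i := fun i =>
    vecMul_nonneg hv (aorLower_inv_nonneg hγ hB) i
  have hyN : y ᵥ* aorUpper γ B = r • v := by
    have h1 : y ᵥ* (aorLower γ B * aor γ ω B) = R • v := by
      rw [← vecMul_vecMul, hyv, hRv]
    rw [hM, vecMul_add, vecMul_smul, vecMul_smul, hyv, hr] at h1
    have h2 : ω • (y ᵥ* aorUpper γ B) = ω • (r • v) := by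
      rw [← sub_eq_zero] at h1 ⊢
      rw [← h1]
      module
    exact smul_right_injective _ hω.ne' h2
  have hxN : aorUpper γ B *ᵥ x = r • (aorLower γ B *ᵥ x) := by
    have h1 : (aorLower γ B * aor γ ω B) *ᵥ x = R • (aorLower γ B *ᵥ x) := by
      rw [← mulVec_mulVec, hRx, mulVec_smul]
    rw [hM, add_mulVec, smul_mulVec, smul_mulVec, hr] at h1
    have h2 : ω • (aorUpper γ B *ᵥ x) = ω • (r • (aorLower γ B *ᵥ x)) := by
      rw [← sub_eq_zero] at h1 ⊢
      rw [← h1]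
      module
    exact smul_right_injective _ hω.ne' h2
  have hr0 : 0 ≤ r := by
    obtain ⟨j, hj⟩ := Function.ne_iff.1 hv0
    have hj : 0 < v j := lt_of_le_of_ne (hv j) (Ne.symm hj)
    have h := congrFun hyN j
    have h' : 0 ≤ (y ᵥ* aorUpper γ B) j :=
      vecMul_nonneg hy0 (aorUpper_nonneg hγ1 hB.1) j
    rw [h] at h'
    exact nonneg_of_mul_nonneg_left h' hj
  refine ⟨r, hr0, hr ▸ hR, ⟨x, hx, hx0, fun i => ?_⟩, y, hy0, hyv ▸ hv, hyv ▸ hv0, fun j => ?_⟩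
  · have h := congrFun hxN i
    simp only [mulVec, dotProduct, Pi.smul_apply, smul_eq_mul] at h
    simp only [← smul_aorLower_sub_aorUpper, sub_mul, Finset.sum_sub_distrib, h, Finset.mul_sum,
      mul_assoc, sub_self]
  · have h := congrFun hyN j
    rw [← hyv] at h
    simp only [vecMul, dotProduct, Pi.smul_apply, smul_eq_mul] at h
    simp only [← smul_aorLower_sub_aorUpper, mul_sub, Finset.sum_sub_distrib, h, Finset.mul_sum,
      mul_left_comm r, sub_self]

/-- The right Perron vector of an irreducible L-matrix is positive. -/
lemma pos_of_weighted_null_vector (hB : IsLMatrix B) (hirr : IsIrreducible B) {t r : ℝ}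
    (ht : 0 < t) (hr : 0 < r) {x : Fin n → ℝ} (hx : ∀ i, 0 ≤ x i) (hx0 : x ≠ 0)
    (h : ∀ i, ∑ j, weight t r i j * B i j * x j = 0) (i : Fin n) : 0 < x i := by
  refine lt_of_le_of_ne (hx i) fun hi => hx0 (funext fun k => ?_)
  -- The zero set of x is closed under edges: in a row a with x a = 0 the diagonal term vanishes, so
  -- a sum of nonpositive terms is zero.
  refine hirr.mem_of_closed (p := fun k => x k = 0) ⟨i, hi.symm⟩ (fun a j ha haj => ?_) k
  have hterm : ∀ b ∈ Finset.univ, weight t r a b * B a b * x b ≤ 0 := by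
    intro b _
    by_cases hab : a = b
    · simp [← hab, ha]
    · exact mul_nonpos_of_nonpos_of_nonneg
        (mul_nonpos_of_nonneg_of_nonpos (weight_pos ht hr a b).le (hB.1 a b hab)) (hx b)
  have := (Finset.sum_eq_zero_iff_of_nonpos hterm).1 (h a) j (Finset.mem_univ j)
  simpa [(weight_pos ht hr a j).ne', haj] using this

lemma weighted_off_diag_sum_eq {t r : ℝ} {y : Fin n → ℝ} {j : Fin n}
    (h : ∑ i, y i * (weight t r i j * B i j) = 0) :
    ∑ i ∈ Finset.univ.erase j, y i * (weight t r i j * B i j) = -(y j * (r * B j j)) := by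
  rw [← Finset.add_sum_erase _ _ (Finset.mem_univ j), weight_self] at h
  linarith

lemma weighted_off_diag_nonpos (hB : IsZMatrix B) {t r : ℝ} (ht : 0 ≤ t) (hr : 0 ≤ r)
    {y : Fin n → ℝ} (hy : ∀ i, 0 ≤ y i) (j : Fin n) :
    ∀ i ∈ Finset.univ.erase j, y i * (weight t r i j * B i j) ≤ 0 := fun i hi =>
  mul_nonpos_of_nonneg_of_nonpos (hy i) (mul_nonpos_of_nonneg_of_nonpos (weight_nonneg ht hr i j)
    (hB i j (Finset.ne_of_mem_erase hi)))

/-- The support of a left Perron vector is closed under the edges of the matrix. -/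
lemma support_closed_of_left_null (hB : IsLMatrix B) {t r : ℝ} (ht : 0 < t) (hr : 0 < r)
    {y : Fin n → ℝ} (hy : ∀ i, 0 ≤ y i)
    (h : ∀ j, ∑ i, y i * (weight t r i j * B i j) = 0) {i j : Fin n} (hi : 0 < y i)
    (hij : B i j ≠ 0) : 0 < y j := by
  refine lt_of_le_of_ne (hy j) fun hj => ?_
  have hne : i ≠ j := by rintro rfl; exact hi.ne hj
  have h1 := weighted_off_diag_sum_eq (h j)
  rw [← hj, zero_mul, neg_zero] at h1
  have := (Finset.sum_eq_zero_iff_of_nonpos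
    (weighted_off_diag_nonpos hB.1 ht.le hr.le hy j)).1 h1 i (by simp [hne])
  simp [hi.ne', (weight_pos ht hr i j).ne', hij] at this

/-- The support of a left Perron vector has no isolated point. -/
lemma exists_ne_of_left_null (hB : IsLMatrix B) {t r : ℝ} (hr : 0 < r)
    {y : Fin n → ℝ} (hy : ∀ i, 0 ≤ y i)
    (h : ∀ j, ∑ i, y i * (weight t r i j * B i j) = 0) {j : Fin n} (hj : 0 < y j) :
    ∃ i, i ≠ j ∧ 0 < y i := by
  by_contra! hcon
  have h1 := weighted_off_diag_sum_eq (h j)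
  rw [Finset.sum_eq_zero] at h1
  · have := mul_pos hj (mul_pos hr (hB.2 j))
    linarith
  · intro i hi
    rw [le_antisymm (hcon i (Finset.ne_of_mem_erase hi)) (hy i), zero_mul]

/-- The Perron root of an irreducible L-matrix of order at least two is positive. -/
lemma perron_root_pos {m : ℕ} (hm : m ≠ 0) {B : Matrix (Fin (m + 1)) (Fin (m + 1)) ℝ}
    (hγ : 0 ≤ γ) (hγ1 : γ ≤ 1) (hB : IsLMatrix B) (hirr : IsIrreducible B) {r : ℝ} (hr : 0 ≤ r)
    {y : Fin (m + 1) → ℝ} (hy : ∀ i, 0 ≤ y i) (hv : ∀ j, 0 ≤ (y ᵥ* aorLower γ B) j)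
    (hv0 : y ᵥ* aorLower γ B ≠ 0)
    (h : ∀ j, ∑ i, y i * (weight (1 - γ + γ * r) r i j * B i j) = 0) : 0 < r := by
  refine lt_of_le_of_ne hr fun hr0 => ?_
  subst hr0
  -- At r = 0 the diagonal term of each column drops out, so every off-diagonal term is zero. Below
  -- the diagonal the weight is 1-γ, which leaves γ = 1 as a separate case.
  have hterm : ∀ i j, i ≠ j → y i * (weight (1 - γ + γ * 0) 0 i j * B i j) = 0 := by
    intro i j hne
    have h1 := weighted_off_diag_sum_eq (h j)
    rw [zero_mul (B j j), mul_zero (y j), neg_zero] at h1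
    exact (Finset.sum_eq_zero_iff_of_nonpos
      (weighted_off_diag_nonpos hB.1 (by linarith) le_rfl hy j)).1 h1 i (by simp [hne])
  have hup : ∀ i j, 0 < y i → i < j → B i j = 0 := by
    intro i j hi hij
    simpa [weight_of_gt hij, hi.ne'] using hterm i j hij.ne
  have hpos : ∀ i, 0 < y i := by
    refine hirr.mem_of_closed (p := fun i => 0 < y i) ?_ fun i j hi hij => ?_
    · by_contra! hcon
      have : y = 0 := funext fun i => le_antisymm (hcon i) (hy i)
      exact hv0 (by rw [this, zero_vecMul])
    · rcases lt_trichotomy i j with hlt | rfl | hlt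
      · exact absurd (hup i j hi hlt) hij
      · exact hi
      have h1 := hterm i j hlt.ne'
      simp only [weight_of_lt hlt, mul_zero, add_zero, mul_eq_zero, hi.ne', hij, or_false,
        false_or] at h1
      have hγ' : γ = 1 := by linarith
      subst hγ'
      -- For γ = 1 the sign of v = yM decides: if y j = 0, the entry b_{ij} < 0 would make v j
      -- negative.
      refine lt_of_le_of_ne (hy j) fun hj => ?_
      have h2 := hv j
      have h3 : (y ᵥ* aorLower 1 B) j < 0 := by
        have hBij : B i j < 0 := lt_of_le_of_ne (hB.1 i j hlt.ne') hij
        simp only [vecMul, dotProduct]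
        refine Finset.sum_neg' (fun k _ => ?_) ⟨i, Finset.mem_univ i, ?_⟩
        · rw [aorLower_apply]
          split_ifs with h4 h5
          · exact mul_nonpos_of_nonneg_of_nonpos (hy k) (by simpa using hB.1 k j h4.ne')
          · simp [h5, ← hj]
          · simp
        · rw [aorLower_apply, if_pos hlt, one_mul]
          exact mul_neg_of_pos_of_neg hi hBij
      linarith
  obtain ⟨j, hj, hj'⟩ := hirr.exists_ne_zero hm 0
  -- The off-diagonal entries of the first row all lie above the diagonal, so they would all vanish.
  exact hj' (hup 0 j (hpos 0) (Fin.pos_of_ne_zero hj))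

end Splitting

/-! ### Entries and sign pattern of the preconditioned matrix. -/

section Precond

variable {α A : Matrix (Fin n) (Fin n) ℝ}

lemma precond_apply (α A : Matrix (Fin n) (Fin n) ℝ) (i j : Fin n) :
    precond α A i j = A i j + ∑ k, -α i k * A i k * A k j := by
  rw [precond, Matrix.add_mul, Matrix.one_mul, Matrix.add_apply, Matrix.mul_apply]
  simp [Q2]

lemma precond_apply_of_ne (hα : ∀ i, α i i = 0) (hA : ∀ i, A i i = 1) {i j : Fin n} (h : i ≠ j) :
    precond α A i j = offDiagExpr α A i j := by
  have hs : (Finset.univ.erase i).erase j = Finset.univ.filter fun k => k ≠ i ∧ k ≠ j := by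
    ext k
    simp [and_comm]
  rw [precond_apply, offDiagExpr, ← Finset.add_sum_erase _ _ (Finset.mem_univ i),
    ← Finset.add_sum_erase _ _ (Finset.mem_erase.2 ⟨h.symm, Finset.mem_univ j⟩), hs, hα, hA j]
  simp only [neg_mul, Finset.sum_neg_distrib]
  ring

lemma precond_apply_self (hα : ∀ i, α i i = 0) (hA : ∀ i, A i i = 1) (i : Fin n) :
    precond α A i i =
      1 - ∑ k ∈ Finset.univ.filter (fun k => k ≠ i), α i k * A i k * A k i := by
  have hs : Finset.univ.erase i = Finset.univ.filter fun k => k ≠ i := by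
    ext k
    simp
  rw [precond_apply, ← Finset.add_sum_erase _ _ (Finset.mem_univ i), hs, hα, hA]
  simp only [neg_mul, Finset.sum_neg_distrib]
  ring

lemma isLMatrix_precond (hα : ∀ i, α i i = 0) (hA : ∀ i, A i i = 1)
    (hsum : ∀ i, ∑ k ∈ Finset.univ.filter (fun k => k ≠ i), α i k * A i k * A k i < 1)
    (hW : WeakIneq α A) : IsLMatrix (precond α A) := by
  refine ⟨fun i j h => ?_, fun i => ?_⟩
  · rw [precond_apply_of_ne hα hA h]
    exact hW i j h
  · rw [precond_apply_self hα hA]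
    linarith [hsum i]

lemma mul_nonpos_entry (hα : ∀ i, α i i = 0) (hα0 : ∀ i j, i ≠ j → 0 ≤ α i j) (hA : IsZMatrix A)
    (i k : Fin n) : α i k * A i k ≤ 0 := by
  by_cases h : i = k
  · simp [← h, hα]
  · exact mul_nonpos_of_nonneg_of_nonpos (hα0 i k h) (hA i k h)

/-- Where a_{ij} = 0 the inequality is automatic, since only products of two nonpositive numbers are
subtracted. -/
lemma StrictTypeIneq.weakIneq (hα : ∀ i, α i i = 0) (hα0 : ∀ i j, i ≠ j → 0 ≤ α i j)
    (hA : IsZMatrix A) (h : StrictTypeIneq α A) : WeakIneq α A := by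
  intro i j hij
  rcases (hA i j hij).lt_or_eq with hlt | heq
  · rcases h with ⟨-, h⟩ | h
    · exact h i j hij hlt
    · exact (h i j hij hlt).le
  · rw [offDiagExpr, heq, mul_zero, zero_sub, neg_nonpos]
    refine Finset.sum_nonneg fun k hk => ?_
    exact mul_nonneg_of_nonpos_of_nonpos (mul_nonpos_entry hα hα0 hA i k)
      (hA k j (Finset.mem_filter.1 hk).2.2)

lemma StrictTypeIneq.isIrreducible (hα : ∀ i, α i i = 0) (hA1 : ∀ i, A i i = 1)
    (hA : IsZMatrix A) (hirr : IsIrreducible A) (h : StrictTypeIneq α A) :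
    IsIrreducible (precond α A) := by
  rcases h with ⟨h, -⟩ | h
  · exact h
  · refine hirr.of_support fun i j hij hne => ?_
    rw [precond_apply_of_ne hα hA1 hij]
    exact (h i j hij (lt_of_le_of_ne (hA i j hij) hne)).ne

end Precond

/-! ### The gap vector and its positivity. -/

section Gap

variable {α A : Matrix (Fin n) (Fin n) ℝ} {γ r : ℝ}

/-- The weight with which the entry `a_{k,j}` contributes to the gap in the row `i`. -/
noncomputable def gapCoef (γ r : ℝ) (i k j : Fin n) : ℝ :=
  if k < i then
    if j < k then 0 else if j = k then -(1 - γ) else if j < i then γ else if j = i then 1 else 0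
  else
    r⁻¹ * if j < i then 1 - γ + γ * r else if j = i then r + 1 - γ else
      if j < k then 1 - γ else if j = k then 0 else 1

/-- The gap between a Perron vector `x` of `A` and a Perron vector of the preconditioned matrix. -/
noncomputable def gap (γ r : ℝ) (α A : Matrix (Fin n) (Fin n) ℝ) (x : Fin n → ℝ) (i : Fin n) : ℝ :=
  ∑ k, -α i k * A i k * ∑ j, -(gapCoef γ r i k j * A k j) * x j

lemma weight_sub_weight_of_lt {i k : Fin n} (h : k < i) (j : Fin n) :
    weight (1 - γ + γ * r) r i j - weight (1 - γ + γ * r) r k j = -(1 - r) * gapCoef γ r i k j := by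
  unfold weight gapCoef
  split_ifs <;> first | (exfalso; omega) | ring

lemma weight_sub_weight_of_gt (hr : r ≠ 0) {i k : Fin n} (h : i < k) (j : Fin n) :
    weight (1 - γ + γ * r) r i j - r⁻¹ * weight (1 - γ + γ * r) r k j =
      -(1 - r) * gapCoef γ r i k j := by
  unfold weight gapCoef
  split_ifs <;> first | (exfalso; omega) | (field_simp; ring)

/-- A multiple w of the null equation of row k may be subtracted. The choice w = 1 for k < i, and w
= r⁻¹ for k > i, leaves coefficients that are (r - 1) times numbers nonnegative off j = k and
nonpositive at j = k. -/
lemma sum_weight_mul_entry (hr : r ≠ 0) {x : Fin n → ℝ}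
    (hx : ∀ k, ∑ j, weight (1 - γ + γ * r) r k j * A k j * x j = 0) {i k : Fin n} (h : i ≠ k) :
    ∑ j, weight (1 - γ + γ * r) r i j * A k j * x j =
      (1 - r) * ∑ j, -(gapCoef γ r i k j * A k j) * x j := by
  obtain ⟨w, hw⟩ : ∃ w : ℝ, ∀ j, weight (1 - γ + γ * r) r i j - w * weight (1 - γ + γ * r) r k j =
      -(1 - r) * gapCoef γ r i k j := by
    rcases lt_or_gt_of_ne h with h | h
    · exact ⟨r⁻¹, weight_sub_weight_of_gt hr h⟩
    · exact ⟨1, fun j => by rw [one_mul, weight_sub_weight_of_lt h]⟩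
  calc ∑ j, weight (1 - γ + γ * r) r i j * A k j * x j
      = ∑ j, weight (1 - γ + γ * r) r i j * A k j * x j -
          w * ∑ j, weight (1 - γ + γ * r) r k j * A k j * x j := by rw [hx, mul_zero, sub_zero]
    _ = (1 - r) * ∑ j, -(gapCoef γ r i k j * A k j) * x j := by
      rw [Finset.mul_sum, Finset.mul_sum, ← Finset.sum_sub_distrib]
      refine Finset.sum_congr rfl fun j _ => ?_
      linear_combination A k j * x j * hw j

lemma sum_weight_mul_precond (hα : ∀ i, α i i = 0) (hr : r ≠ 0) {x : Fin n → ℝ}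
    (hx : ∀ k, ∑ j, weight (1 - γ + γ * r) r k j * A k j * x j = 0) (i : Fin n) :
    ∑ j, weight (1 - γ + γ * r) r i j * precond α A i j * x j = (1 - r) * gap γ r α A x i := by
  have h1 : ∀ j, weight (1 - γ + γ * r) r i j * precond α A i j * x j =
      weight (1 - γ + γ * r) r i j * A i j * x j +
        ∑ k, -α i k * A i k * (weight (1 - γ + γ * r) r i j * A k j * x j) := by
    intro j
    rw [precond_apply, mul_add, add_mul, Finset.mul_sum, Finset.sum_mul]
    congr 1
    exact Finset.sum_congr rfl fun k _ => by ring
  simp only [h1, Finset.sum_add_distrib, hx, zero_add, gap]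
  rw [Finset.sum_comm, Finset.mul_sum]
  refine Finset.sum_congr rfl fun k _ => ?_
  rw [← Finset.mul_sum]
  by_cases h : i = k
  · simp [← h, hα]
  · rw [sum_weight_mul_entry hr hx h]
    ring

/-- The difference of the Perron roots of `A` and of the preconditioned matrix, in terms of a right
Perron vector of the former and a left Perron vector of the latter. -/
lemma perron_root_sub_mul (hα : ∀ i, α i i = 0) (hr : r ≠ 0) {s : ℝ} {x y : Fin n → ℝ}
    (hx : ∀ k, ∑ j, weight (1 - γ + γ * r) r k j * A k j * x j = 0)
    (hy : ∀ j, ∑ i, y i * (weight (1 - γ + γ * s) s i j * precond α A i j) = 0) :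
    (r - s) * ∑ j, (y ᵥ* aorLower γ (precond α A)) j * x j =
      (1 - r) * ∑ i, y i * gap γ r α A x i := by
  have h1 : (1 - r) * ∑ i, y i * gap γ r α A x i =
      ∑ j, (∑ i, y i * (weight (1 - γ + γ * r) r i j * precond α A i j)) * x j := by
    simp only [Finset.sum_mul]
    rw [Finset.sum_comm, Finset.mul_sum]
    refine Finset.sum_congr rfl fun i _ => ?_
    rw [mul_left_comm, ← sum_weight_mul_precond hα hr hx, Finset.mul_sum]
    exact Finset.sum_congr rfl fun j _ => by ring
  rw [h1, Finset.mul_sum]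
  refine Finset.sum_congr rfl fun j _ => ?_
  -- Subtracting the null equation of y leaves (rM - N) - (sM - N) = (r - s)M.
  rw [← sub_zero (∑ i, y i * (weight (1 - γ + γ * r) r i j * precond α A i j)), ← hy j,
    ← Finset.sum_sub_distrib]
  simp only [← smul_aorLower_sub_aorUpper, vecMul, dotProduct]
  rw [← mul_assoc, Finset.mul_sum]
  congr 1
  exact Finset.sum_congr rfl fun i _ => by ring

/-- The one positive entry of row k is a_{kk} = 1, and exactly there the coefficient is nonpositive.
-/
lemma neg_gapCoef_mul_nonneg (hγ : 0 ≤ γ) (hγ1 : γ ≤ 1) (hr : 0 < r) (hA : IsZMatrix A)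
    (hA1 : ∀ i, A i i = 1) {i k : Fin n} (h : i ≠ k) (j : Fin n) :
    0 ≤ -(gapCoef γ r i k j * A k j) := by
  by_cases hkj : k = j
  · subst hkj
    unfold gapCoef
    rw [hA1]
    split_ifs <;> first | (exfalso; omega) | simp [hγ1]
  · rw [neg_nonneg]
    refine mul_nonpos_of_nonneg_of_nonpos ?_ (hA k j hkj)
    have : 0 ≤ r⁻¹ := (inv_pos.2 hr).le
    have : 0 ≤ γ * r := mul_nonneg hγ hr.le
    unfold gapCoef
    split_ifs <;>
      first | (exfalso; omega) | exact mul_nonneg ‹_› (by linarith) | linarith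

lemma gap_term_nonneg (hγ : 0 ≤ γ) (hγ1 : γ ≤ 1) (hr : 0 < r) (hA : IsZMatrix A)
    (hA1 : ∀ i, A i i = 1) (hα : ∀ i, α i i = 0) (hα0 : ∀ i j, i ≠ j → 0 ≤ α i j) {x : Fin n → ℝ}
    (hx : ∀ i, 0 < x i) (i k : Fin n) :
    0 ≤ -α i k * A i k * ∑ j, -(gapCoef γ r i k j * A k j) * x j := by
  by_cases h : i = k
  · simp [← h, hα]
  · refine mul_nonneg ?_ (Finset.sum_nonneg fun j _ =>
      mul_nonneg (neg_gapCoef_mul_nonneg hγ hγ1 hr hA hA1 h j) (hx j).le)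
    linarith [mul_nonpos_entry hα hα0 hA i k]

lemma gap_nonneg (hγ : 0 ≤ γ) (hγ1 : γ ≤ 1) (hr : 0 < r) (hA : IsZMatrix A)
    (hA1 : ∀ i, A i i = 1) (hα : ∀ i, α i i = 0) (hα0 : ∀ i j, i ≠ j → 0 ≤ α i j) {x : Fin n → ℝ}
    (hx : ∀ i, 0 < x i) (i : Fin n) : 0 ≤ gap γ r α A x i :=
  Finset.sum_nonneg fun k _ => gap_term_nonneg hγ hγ1 hr hA hA1 hα hα0 hx i k

lemma gap_pos (hγ : 0 ≤ γ) (hγ1 : γ ≤ 1) (hr : 0 < r) (hA : IsZMatrix A)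
    (hA1 : ∀ i, A i i = 1) (hα : ∀ i, α i i = 0) (hα0 : ∀ i j, i ≠ j → 0 ≤ α i j) {x : Fin n → ℝ}
    (hx : ∀ i, 0 < x i) {i k j : Fin n} (hik : α i k * A i k < 0)
    (hkj : gapCoef γ r i k j * A k j ≠ 0) : 0 < gap γ r α A x i := by
  have hne : i ≠ k := by
    rintro rfl
    simp [hα] at hik
  refine Finset.sum_pos' (fun k _ => gap_term_nonneg hγ hγ1 hr hA hA1 hα hα0 hx i k)
    ⟨k, Finset.mem_univ k, mul_pos (by linarith) ?_⟩
  have hnn := neg_gapCoef_mul_nonneg hγ hγ1 hr hA hA1 hne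
  exact Finset.sum_pos' (fun j _ => mul_nonneg (hnn j) (hx j).le)
    ⟨j, Finset.mem_univ j, mul_pos (lt_of_le_of_ne (hnn j) (neg_ne_zero.2 hkj).symm) (hx j)⟩

/-- For `γ < 1`, the gap is positive in each row changed by the preconditioner. -/
lemma gap_pos_of_lt_one {m : ℕ} (hm : m ≠ 0) {α A : Matrix (Fin (m + 1)) (Fin (m + 1)) ℝ}
    (hirr : IsIrreducible A) (hγ : 0 ≤ γ) (hγ1 : γ < 1) (hr : 0 < r) (hA : IsZMatrix A)
    (hA1 : ∀ i, A i i = 1) (hα : ∀ i, α i i = 0) (hα0 : ∀ i j, i ≠ j → 0 ≤ α i j)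
    {x : Fin (m + 1) → ℝ} (hx : ∀ i, 0 < x i) {i k : Fin (m + 1)} (hik : α i k * A i k < 0) :
    0 < gap γ r α A x i := by
  have hpos := @gap_pos _ α A γ r hγ hγ1.le hr hA hA1 hα hα0 x hx i k
  rcases lt_trichotomy i k with h | rfl | h
  · obtain ⟨j, hj, hkj⟩ := hirr.exists_ne_zero hm k
    refine hpos (j := j) hik (mul_ne_zero ?_ hkj)
    have : 0 ≤ γ * r := mul_nonneg hγ hr.le
    unfold gapCoef
    rw [if_neg h.not_gt]
    refine mul_ne_zero (inv_pos.2 hr).ne' ?_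
    split_ifs <;> first | contradiction | apply ne_of_gt; linarith
  · simp [hα] at hik
  -- For k < i the diagonal entry a_{kk} suffices, with coefficient -(1-γ) ≠ 0.
  · refine hpos (j := k) hik ?_
    rw [hA1, gapCoef, if_pos h, if_neg (lt_irrefl k), if_pos rfl, mul_one]
    linarith

/-- A pair of entries `a_{i,k}`, `a_{k,j}` that makes the gap in the row `i` positive for
`γ = 1`. -/
def HasGapPath (α A : Matrix (Fin n) (Fin n) ℝ) (i : Fin n) : Prop :=
  ∃ k j, α i k * A i k < 0 ∧ A k j < 0 ∧ (k < j ∧ j ≤ i ∨ i < k ∧ (j ≤ i ∨ k < j))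

/-- At γ = 1 the coefficient vanishes for j ≤ k or j > i when k < i, and for i < j ≤ k when k > i;
the paths are those that avoid these positions. -/
lemma HasGapPath.gap_pos (hr : 0 < r) (hA : IsZMatrix A)
    (hA1 : ∀ i, A i i = 1) (hα : ∀ i, α i i = 0) (hα0 : ∀ i j, i ≠ j → 0 ≤ α i j)
    {x : Fin n → ℝ} (hx : ∀ i, 0 < x i) {i : Fin n} (h : HasGapPath α A i) :
    0 < gap 1 r α A x i := by
  obtain ⟨k, j, hik, hkj, h⟩ := h
  refine PrecAOR.gap_pos zero_le_one le_rfl hr hA hA1 hα hα0 hx hik (mul_ne_zero ?_ hkj.ne)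
  have := hr.ne'
  unfold gapCoef
  split_ifs <;> first | (exfalso; omega) | simp [this]

lemma neg_of_path_pos (hα : ∀ i, α i i = 0) (hα0 : ∀ i j, i ≠ j → 0 ≤ α i j) (hA : IsZMatrix A)
    {i k j : Fin n} (hkj : k ≠ j) (h : 0 < α i k * A i k * A k j) :
    α i k * A i k < 0 ∧ A k j < 0 := by
  have h1 := mul_nonpos_entry hα hα0 hA i k
  have h2 := hA k j hkj
  constructor
  · refine lt_of_le_of_ne h1 fun h0 => ?_
    simp [h0] at h
  · refine lt_of_le_of_ne h2 fun h0 => ?_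
    simp [h0] at h

lemma hasGapPath_of_path_pos (hα : ∀ i, α i i = 0) (hα0 : ∀ i j, i ≠ j → 0 ≤ α i j)
    (hA : IsZMatrix A) {i k j : Fin n} (hp : k < j ∧ j ≤ i ∨ i < k ∧ (j ≤ i ∨ k < j))
    (h : 0 < α i k * A i k * A k j) : HasGapPath α A i := by
  have hkj : k ≠ j := by omega
  obtain ⟨h1, h2⟩ := neg_of_path_pos hα hα0 hA hkj h
  exact ⟨k, j, h1, h2, hp⟩

lemma hasGapPath_of_diag_pos (hα : ∀ i, α i i = 0) (hα0 : ∀ i j, i ≠ j → 0 ≤ α i j)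
    (hA : IsZMatrix A) {i k : Fin n} (h : 0 < α i k * A i k * A k i) : HasGapPath α A i := by
  have hki : k ≠ i := by
    rintro rfl
    simp [hα] at h
  exact hasGapPath_of_path_pos hα hα0 hA (j := i) (by omega) h

lemma hasGapPath_of_delta_pos (hα : ∀ i, α i i = 0) (hα0 : ∀ i j, i ≠ j → 0 ≤ α i j)
    (hA : IsZMatrix A) {i j : Fin n} (h : 0 < delta α A 1 i j) : HasGapPath α A i := by
  simp only [delta, sub_self, zero_mul, zero_add, one_mul] at h
  split_ifs at h with h1 h2
  all_goals
    rw [← Finset.sum_const_zero] at h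
    obtain ⟨k, hk, hpos⟩ := Finset.exists_lt_of_sum_lt h
    have hk := (Finset.mem_filter.1 hk).2
  · exact hasGapPath_of_diag_pos hα hα0 hA hpos
  · exact hasGapPath_of_path_pos hα hα0 hA (by omega) hpos
  · exact hasGapPath_of_path_pos hα hα0 hA (by omega) hpos

end Gap

/-! ### From the listed conditions to a positive gap. -/

section Conditions

variable {m : ℕ} {α A : Matrix (Fin (m + 1)) (Fin (m + 1)) ℝ}

lemma hasGapPath_last (hm : m ≠ 0) (hirr : IsIrreducible A) (hA : IsZMatrix A)
    (h : A (Fin.last m) 0 < 0) (h' : 0 < α (Fin.last m) 0) : HasGapPath α A (Fin.last m) := by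
  obtain ⟨j, hj, hj'⟩ := hirr.exists_ne_zero hm 0
  exact ⟨0, j, mul_neg_of_pos_of_neg h' h, lt_of_le_of_ne (hA 0 j hj.symm) hj',
    Or.inl ⟨Fin.pos_of_ne_zero hj, Fin.le_last j⟩⟩

/-- No index lies strictly between i and k = i+1, so every off-diagonal nonzero entry of row k
completes a path. -/
lemma hasGapPath_of_superdiag (hm : m ≠ 0) (hirr : IsIrreducible A) (hA : IsZMatrix A) {k : Fin m}
    (h : A k.castSucc k.succ < 0) (h' : 0 < α k.castSucc k.succ) : HasGapPath α A k.castSucc := by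
  obtain ⟨j, hj, hj'⟩ := hirr.exists_ne_zero hm k.succ
  refine ⟨k.succ, j, mul_neg_of_pos_of_neg h' h, lt_of_le_of_ne (hA _ j hj.symm) hj',
    Or.inr ⟨Fin.castSucc_lt_succ, ?_⟩⟩
  simp only [Fin.le_def, Fin.lt_def, Fin.val_castSucc, Fin.val_succ, ne_eq, Fin.ext_iff] at hj ⊢
  omega

lemma hasGapPath_of_mul_superdiag_pos (hα : ∀ i, α i i = 0) (hα0 : ∀ i j, i ≠ j → 0 ≤ α i j)
    (hA : IsZMatrix A) {i : Fin (m + 1)} {k : Fin m}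
    (h : 0 < α i k.castSucc * A i k.castSucc * A k.castSucc k.succ) : HasGapPath α A i := by
  have hik : i ≠ k.castSucc := by
    rintro rfl
    simp [hα] at h
  refine hasGapPath_of_path_pos hα hα0 hA ?_ h
  simp only [Fin.le_def, Fin.lt_def, Fin.val_castSucc, Fin.val_succ, ne_eq, Fin.ext_iff] at hik ⊢
  omega

lemma RowCond16.hasGapPath (hm : m ≠ 0) (hirr : IsIrreducible A) (hα : ∀ i, α i i = 0)
    (hα0 : ∀ i j, i ≠ j → 0 ≤ α i j) (hA : IsZMatrix A) {i : Fin (m + 1)} (hi : i < Fin.last m)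
    (h : RowCond16 α A i) : HasGapPath α A i := by
  rcases h with ⟨j, h⟩ | ⟨k, rfl, h, h'⟩ | ⟨j, h⟩ | ⟨j, hj, h⟩ | ⟨j, hj, h⟩ | ⟨k, h⟩
  · exact hasGapPath_of_delta_pos hα hα0 hA h
  · exact hasGapPath_of_superdiag hm hirr hA h h'
  · exact hasGapPath_of_diag_pos hα hα0 hA h
  · exact hasGapPath_of_path_pos hα hα0 hA (Or.inr ⟨hi, Or.inl hj⟩) h
  · exact hasGapPath_of_path_pos hα hα0 hA (Or.inr ⟨hj, Or.inl (Fin.zero_le i)⟩) h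
  · exact hasGapPath_of_mul_superdiag_pos hα hα0 hA h

lemma RowCond17.hasGapPath (hm : m ≠ 0) (hirr : IsIrreducible A) (hα : ∀ i, α i i = 0)
    (hα0 : ∀ i j, i ≠ j → 0 ≤ α i j) (hA : IsZMatrix A) {i : Fin (m + 1)} (hi : i < Fin.last m)
    (h : RowCond17 α A i) : HasGapPath α A i := by
  rcases h with h | ⟨j, hj, hji, h⟩
  · exact h.hasGapPath hm hirr hα hα0 hA hi
  · exact hasGapPath_of_path_pos hα hα0 hA (Or.inl ⟨hj, hji⟩) h

lemma exists_mul_neg (hα : Admissible α A) (hA : IsZMatrix A) : ∃ i j, α i j * A i j < 0 := by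
  by_contra! h
  refine hα.2.2 (Finset.sum_eq_zero fun i _ => Finset.sum_eq_zero fun j _ => ?_)
  exact le_antisymm (mul_nonpos_entry hα.1 hα.2.1 hA i j) (h i j)

lemma CondII.exists_hasGapPath (hm : m ≠ 0) (hirr : IsIrreducible A) (hα : Admissible α A)
    (hA : IsZMatrix A) (h : CondII α A) : ∃ i, HasGapPath α A i := by
  obtain ⟨hα1, hα0, -⟩ := id hα
  rcases h with ⟨i, j, h⟩ | ⟨h, h'⟩ | ⟨k, h, h'⟩ | ⟨i, j, h⟩ | ⟨i, j, hi, hj, h⟩ |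
    ⟨i, j, hi, hj, h⟩ | ⟨i, k, h⟩ | ⟨i, j, hi, hj, hji, h⟩ | ⟨h, h'⟩
  · exact ⟨i, hasGapPath_of_delta_pos hα1 hα0 hA h⟩
  · exact ⟨_, hasGapPath_last hm hirr hA h h'⟩
  · exact ⟨_, hasGapPath_of_superdiag hm hirr hA h h'⟩
  · exact ⟨i, hasGapPath_of_diag_pos hα1 hα0 hA h⟩
  · exact ⟨i, hasGapPath_of_path_pos hα1 hα0 hA (Or.inr ⟨hi, Or.inl hj⟩) h⟩
  · exact ⟨i, hasGapPath_of_path_pos hα1 hα0 hA (Or.inr ⟨hj, Or.inl (Fin.zero_le i)⟩) h⟩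
  · exact ⟨i, hasGapPath_of_mul_superdiag_pos hα1 hα0 hA h⟩
  · exact ⟨i, hasGapPath_of_path_pos hα1 hα0 hA (Or.inl ⟨hj, hji⟩) h⟩
  -- Any active entry (i, j) extends to a path along the cycle 1 → 2 → ⋯ → n → 1.
  · obtain ⟨i, j, hij⟩ := exists_mul_neg hα hA
    refine ⟨i, ?_⟩
    induction j using Fin.lastCases with
    | last =>
      refine hasGapPath_of_path_pos hα1 hα0 hA (Or.inr ⟨?_, Or.inl (Fin.zero_le i)⟩)
        (mul_pos_of_neg_of_neg hij h)
      refine lt_of_le_of_ne (Fin.le_last i) ?_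
      rintro rfl
      simp [hα1] at hij
    | cast k =>
      exact hasGapPath_of_mul_superdiag_pos hα1 hα0 hA (mul_pos_of_neg_of_neg hij (h' k))

lemma Conditions.weakIneq {γ : ℝ} (hα : Admissible α A) (hA : IsZMatrix A)
    (h : Conditions α A γ) : WeakIneq α A := by
  rcases h with ⟨-, h⟩ | ⟨-, h, -⟩ | ⟨-, h, -⟩ | ⟨-, h, -⟩
  · exact h.weakIneq hα.1 hα.2.1 hA
  · exact h.weakIneq hα.1 hα.2.1 hA
  · exact h
  · exact h

/-- Under the conditions, the gap is positive somewhere on each set of at least two indices that is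
closed under the edges of the preconditioned matrix. -/
lemma Conditions.exists_gap_pos (hm : m ≠ 0) {γ r : ℝ} (hγ : 0 ≤ γ) (hr : 0 < r)
    (hirr : IsIrreducible A) (hα : Admissible α A) (hA : IsZMatrix A) (hA1 : ∀ i, A i i = 1)
    (h : Conditions α A γ) {x : Fin (m + 1) → ℝ} (hx : ∀ i, 0 < x i) {p : Fin (m + 1) → Prop}
    (hp : ∃ i, p i) (hp2 : ∀ j, p j → ∃ i, i ≠ j ∧ p i)
    (hcl : ∀ i j, p i → precond α A i j ≠ 0 → p j) : ∃ i, p i ∧ 0 < gap γ r α A x i := by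
  obtain ⟨hα1, hα0, -⟩ := id hα
  rcases h with ⟨hγ1, h⟩ | ⟨rfl, h, hII⟩ | ⟨hγ1, -, hrow⟩ | ⟨rfl, -, hrow, hlast⟩
  · obtain ⟨i, k, hik⟩ := exists_mul_neg hα hA
    exact ⟨i, (h.isIrreducible hα1 hA1 hA hirr).mem_of_closed hp hcl i,
      gap_pos_of_lt_one hm hirr hγ hγ1 hr hA hA1 hα1 hα0 hx hik⟩
  · obtain ⟨i, hi⟩ := hII.exists_hasGapPath hm hirr hα hA
    exact ⟨i, (h.isIrreducible hα1 hA1 hA hirr).mem_of_closed hp hcl i,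
      hi.gap_pos hr hA hA1 hα1 hα0 hx⟩
  -- Two points in the set guarantee one outside the last row, where nothing is assumed.
  · obtain ⟨i, hi, hil⟩ : ∃ i, p i ∧ i ≠ Fin.last m := by
      obtain ⟨i, hi⟩ := hp
      by_cases hil : i = Fin.last m
      · obtain ⟨j, hj, hpj⟩ := hp2 i hi
        exact ⟨j, hpj, hil ▸ hj⟩
      · exact ⟨i, hi, hil⟩
    obtain ⟨k, hik⟩ := hrow i (lt_of_le_of_ne (Fin.le_last i) hil)
    exact ⟨i, hi, gap_pos_of_lt_one hm hirr hγ hγ1 hr hA hA1 hα1 hα0 hx hik⟩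
  · suffices ∃ i, p i ∧ HasGapPath α A i by
      obtain ⟨i, hi, hgap⟩ := this
      exact ⟨i, hi, hgap.gap_pos hr hA hA1 hα1 hα0 hx⟩
    by_contra! hno
    -- Without a path the set can only be {1, n}. The last-row alternatives then give a path from 1
    -- or n, or an edge from n to an interior index.
    have hends : ∀ i, p i → i = 0 ∨ i = Fin.last m := by
      intro i hi
      by_contra! hne
      have hlt := lt_of_le_of_ne (Fin.le_last i) hne.2
      exact hno i hi ((hrow i (Fin.pos_of_ne_zero hne.1) hlt).hasGapPath hm hirr hα1 hα0 hA hlt)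
    have hboth : p 0 ∧ p (Fin.last m) := by
      obtain ⟨i, hi⟩ := hp
      obtain ⟨j, hj, hpj⟩ := hp2 i hi
      rcases hends i hi with rfl | rfl <;> rcases hends j hpj with rfl | rfl
      · exact absurd rfl hj
      · exact ⟨hi, hpj⟩
      · exact ⟨hpj, hi⟩
      · exact absurd rfl hj
    have h0l : (0 : Fin (m + 1)) < Fin.last m := by
      simpa [Fin.lt_def] using Nat.pos_of_ne_zero hm
    rcases hlast with ⟨j, k, -, hkj, h⟩ | ⟨h, h'⟩ | ⟨j, hj, hjl, h⟩ | ⟨h, -⟩ | ⟨h, -⟩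
    · exact hno _ hboth.2
        (hasGapPath_of_path_pos hα1 hα0 hA (Or.inl ⟨hkj, Fin.le_last j⟩) h)
    · exact hno _ hboth.2 (hasGapPath_last hm hirr hA h h')
    · have hfil : (Finset.univ.filter fun k => k < Fin.last m ∧ k ≠ j) =
          Finset.univ.filter fun k => k ≠ Fin.last m ∧ k ≠ j := by
        ext k
        simp [Fin.lt_last_iff_ne_last]
      rw [hfil] at h
      have hpj : p j := by
        refine hcl _ j hboth.2 ?_
        rw [precond_apply_of_ne hα1 hA1 hjl.ne']
        exact h.ne
      rcases hends j hpj with rfl | rfl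
      · exact lt_irrefl _ hj
      · exact lt_irrefl _ hjl
    · exact hno _ hboth.1 (h.hasGapPath hm hirr hα1 hα0 hA h0l)
    · exact hno _ hboth.1 (h.hasGapPath hm hirr hα1 hα0 hA h0l)

end Conditions

/-! ### Comparison of the two roots and conclusion. -/

/-- The trichotomy for the Perron roots of the two matrices `(D - γ L)⁻¹ ((1 - γ) L + U)`. -/
lemma trichotomy_of_sub_mul_eq {r s a b : ℝ} (hr : 0 < r) (hs : 0 ≤ s) (ha : 0 < a) (hb : 0 ≤ b)
    (hb' : 0 < s → 0 < b) (h : (r - s) * a = (1 - r) * b) :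
    (s < r ∧ r < 1) ∨ (s = r ∧ r = 1) ∨ (r < s ∧ 1 < r) := by
  rcases lt_trichotomy r 1 with h1 | h1 | h1
  · refine Or.inl ⟨?_, h1⟩
    -- At s = 0 strict positivity of b is not available, but s < r is immediate.
    rcases hs.eq_or_lt with h0 | h0
    · linarith
    · have := mul_pos (sub_pos.2 h1) (hb' h0)
      rw [← h] at this
      linarith [pos_of_mul_pos_left this ha.le]
  · refine Or.inr (Or.inl ⟨?_, h1⟩)
    rw [h1, sub_self, zero_mul, mul_eq_zero] at h
    rcases h with h | h <;> linarith
  · refine Or.inr (Or.inr ⟨?_, h1⟩)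
    rcases hs.eq_or_lt with h0 | h0
    · rw [← h0, sub_zero] at h
      nlinarith [mul_pos hr ha]
    · have := mul_pos (sub_pos.2 h1) (hb' h0)
      have h2 : 0 < (s - r) * a := by linarith
      linarith [pos_of_mul_pos_left h2 ha.le]

end PrecAOR

open PrecAOR Matrix in
theorem theorem3p7 (m : ℕ) (A α : Matrix (Fin (m + 1)) (Fin (m + 1)) ℝ) (γ ω : ℝ)
    (hω : 0 < ω) (hω1 : ω ≤ 1) (hγ : 0 ≤ γ) (hγ1 : γ ≤ 1)
    (hdiag : ∀ i, A i i = 1)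
    (hL : PrecAOR.IsLMatrix A) (hirr : PrecAOR.IsIrreducible A)
    (hα : PrecAOR.Admissible α A)
    (hsum : ∀ i, ∑ k ∈ Finset.univ.filter (fun k => k ≠ i), α i k * A i k * A k i < 1)
    (hcond : PrecAOR.Conditions α A γ) :
    PrecAOR.ExactlyOne
      (PrecAOR.rho (PrecAOR.aor γ ω (PrecAOR.precond α A)) < PrecAOR.rho (PrecAOR.aor γ ω A) ∧
        PrecAOR.rho (PrecAOR.aor γ ω A) < 1)
      (PrecAOR.rho (PrecAOR.aor γ ω (PrecAOR.precond α A)) = PrecAOR.rho (PrecAOR.aor γ ω A) ∧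
        PrecAOR.rho (PrecAOR.aor γ ω A) = 1)
      (PrecAOR.rho (PrecAOR.aor γ ω (PrecAOR.precond α A)) > PrecAOR.rho (PrecAOR.aor γ ω A) ∧
        PrecAOR.rho (PrecAOR.aor γ ω A) > 1) := by
  -- In order one Q₂ would be zero, against admissibility.
  have hm : m ≠ 0 := by
    rintro rfl
    obtain ⟨i, j, hij⟩ := exists_mul_neg hα hL.1
    rw [Subsingleton.elim (α := Fin 1) j i, hα.1, zero_mul] at hij
    exact lt_irrefl _ hij
  obtain ⟨hα1, hα0, -⟩ := id hα
  have hL2 := isLMatrix_precond hα1 hdiag hsum (hcond.weakIneq hα hL.1)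
  obtain ⟨r, hr0, hrho, ⟨x, hx0, hxne, hx⟩, z, hz, hzv, hzv0, hz0⟩ :=
    exists_aor_perron hω hω1 hγ hγ1 hL
  obtain ⟨s, hs0, hrho2, -, y, hy0, hv, hv0, hy⟩ := exists_aor_perron hω hω1 hγ hγ1 hL2
  have hr : 0 < r := perron_root_pos hm hγ hγ1 hL hirr hr0 hz hzv hzv0 hz0
  have hweight : ∀ {q : ℝ}, 0 < q → 0 < 1 - γ + γ * q := fun {q} hq => by
    rcases hγ.eq_or_lt with h | h
    · simp [← h]
    · linarith [mul_pos h hq]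
  have hxpos := pos_of_weighted_null_vector hL hirr (hweight hr) hr hx0 hxne hx
  have hgap := gap_nonneg hγ hγ1 hr hL.1 hdiag hα1 hα0 hxpos
  have key := trichotomy_of_sub_mul_eq hr hs0 (a := ∑ j, (y ᵥ* aorLower γ (precond α A)) j * x j)
    (b := ∑ i, y i * gap γ r α A x i)
    (by
      obtain ⟨j, hj⟩ := Function.ne_iff.1 hv0
      exact Finset.sum_pos' (fun i _ => mul_nonneg (hv i) (hxpos i).le)
        ⟨j, Finset.mem_univ j, mul_pos (lt_of_le_of_ne (hv j) (Ne.symm hj)) (hxpos j)⟩)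
    (Finset.sum_nonneg fun i _ => mul_nonneg (hy0 i) (hgap i))
    (fun hs => by
      have hp : ∃ i, 0 < y i := by
        by_contra! hcon
        have : y = 0 := funext fun i => le_antisymm (hcon i) (hy0 i)
        exact hv0 (by rw [this, zero_vecMul])
      obtain ⟨i, hi, hgi⟩ := hcond.exists_gap_pos hm hγ hr hirr hα hL.1 hdiag hxpos hp
        (fun j hj => exists_ne_of_left_null hL2 hs hy0 hy hj)
        (fun i j hi hij => support_closed_of_left_null hL2 (hweight hs) hs hy0 hy hi hij)
      exact Finset.sum_pos' (fun i _ => mul_nonneg (hy0 i) (hgap i))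
        ⟨i, Finset.mem_univ i, mul_pos hi hgi⟩)
    (perron_root_sub_mul hα1 hr.ne' hx hy)
  have hone : ENNReal.ofReal (1 - ω + ω * 1) = 1 := by simp
  -- Since ω ≤ 1 the arguments are nonnegative, so the truncation in `ENNReal.ofReal` does not
  -- destroy strictness.
  have hlt : ∀ {a b : ℝ}, 0 ≤ a → a < b →
      ENNReal.ofReal (1 - ω + ω * a) < ENNReal.ofReal (1 - ω + ω * b) := fun {a b} ha hab =>
    (ENNReal.ofReal_lt_ofReal_iff_of_nonneg (by nlinarith)).2 (by nlinarith)
  rw [hrho, hrho2]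
  refine ⟨?_, ?_, ?_, ?_⟩
  · rcases key with ⟨h1, h2⟩ | ⟨h1, h2⟩ | ⟨h1, h2⟩
    · exact Or.inl ⟨hlt hs0 h1, hone ▸ hlt hr0 h2⟩
    · subst h1
      exact Or.inr (Or.inl ⟨rfl, by rw [h2, hone]⟩)
    · exact Or.inr (Or.inr ⟨hlt hr0 h1, hone ▸ hlt zero_le_one h2⟩)
  · exact fun h => h.1.2.ne h.2.2
  · exact fun h => h.1.2.not_gt h.2.2
  · exact fun h => h.2.2.ne' h.1.2
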